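/- \textbf{Model.} There are $N$ servers, each with a queue of buffer size $b$ (the task in service included). Jobs arrive as a Poisson process of rate $N\lambda/k$; each job consists of $k$ tasks whose service times are independent exponentials with rate $1$; every busy server works at rate $1$. Under \emph{batch-filling with probe overhead $d$}, an arriving job samples uniformly at random, without replacement, a set of $kd$ of the $N$ queues (with $kd$ rounded down to an integer, which is assumed to be at most $N$), and its $k$ tasks are assigned one by one to a shortest sampled queue, the queue lengths being updated after each assignment; if some task would be put into a queue that already holds $b$ tasks, the whole job is dropped. Let $S_i(t)$ be the fraction of servers with at least $i$ tasks at time $t$. Then $(S_0(t),\dots,S_b(t))$ is a continuous-time Markov chain on the finite set of all $(s_0,\dots,s_b)$ with $1=s_0\ge s_1\ge\dots\ge s_b\ge 0$ and $Ns_i\in\mathbb{N}$; let $S=(S_0,\dots,S_b)$ be distributed according to its stationary distribution. \textbf{Theorem.} Let $0<\alpha<\tfrac12$ and $0<\beta\le 1$ be constants, let $\lambda=1-\beta N^{-\alpha}$, and let $k=k(N)\in\mathbb{N}$, $h=h(N)\in\mathbb{R}$ and $d=d(N)\in\mathbb{R}$ be such that, as $N\to\infty$, $$k=o\!\left(\frac{N^{1/2-\alpha}}{\log^2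 N}\right),\qquad \frac{k}{\log k}=\Omega(\log N),\qquad h=o(\log k),\qquad h\to\infty,$$ and, for all large $N$, $d\ge \frac{8}{(1-\lambda)h}$ and $\lfloor kd\rfloor\le N$. Let the buffer size be $b=\min\{N^{\alpha},\,N^{1/2-\alpha}/k\}$, rounded down to an integer. Then, for all sufficiently large $N$, under batch-filling with probe overhead $d$, $$\mathbb{E}\left[\max\left\{\sum_{i=1}^b S_i-h\left(1-\tfrac12\beta N^{-\alpha}\right),\,0\right\}\right]\le\frac{5}{\sqrt N\,\log N}.$$ -/

import Mathlib

open Filter Asymptotics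

namespace BatchFilling

noncomputable section

open scoped Classical in
/-- One round of batch-filling: a task joins a shortest queue among the sampled queues `A`.
(Which of several shortest queues is taken does not influence the fractions of servers
with at least `i` tasks.) -/
def joinShortest {N : ℕ} (A : Finset (Fin N)) (q : Fin N → ℕ) : Fin N → ℕ :=
  if hA : A.Nonempty then
    let n := (A.exists_min_image q hA).choose
    Function.update q n (q n + 1)
  else q

/-- Batch-filling: `k` tasks join one by one the shortest queue among the sampled queues `A`,
the queue lengths being updated after every assignment. -/
def batchFill {N : ℕ} (A : Finset (Fin N)) : ℕ → (Fin N → ℕ) → (Fin N → ℕ)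
  | 0, q => q
  | k + 1, q => batchFill A k (joinShortest A q)

/-- A task leaves server `n`. -/
def depart {N : ℕ} (q : Fin N → ℕ) (n : Fin N) : Fin N → ℕ :=
  Function.update q n (q n - 1)

/-- The state space of the Markov chain `S(t) = (S_0(t), …, S_b(t))`, stored through the integers
`c i = N * s_i`: sequences `N = c 0 ≥ c 1 ≥ ⋯ ≥ c b ≥ 0`. -/
abbrev State (N b : ℕ) : Type :=
  {c : Fin (b + 1) → Fin (N + 1) // c 0 = Fin.last N ∧ Antitone c}

/-- The coordinate `s_i`: the fraction of servers that have at least `i` tasks. -/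
def State.frac {N b : ℕ} (s : State N b) (i : Fin (b + 1)) : ℝ := (s.1 i : ℕ) / (N : ℝ)

/-- `∑_{i=1}^b s_i`, the average number of tasks per server. -/
def State.total {N b : ℕ} (s : State N b) : ℝ := ∑ i : Fin b, s.frac i.succ

/-- The state of a system with queue lengths `q n`: `N s_i` is the number of servers
with at least `i` tasks. -/
def toState {N : ℕ} (b : ℕ) (q : Fin N → ℕ) : State N b :=
  ⟨fun i => ⟨(Finset.univ.filter fun n => (i : ℕ) ≤ q n).card,
      Nat.lt_succ_of_le ((Finset.card_le_univ _).trans_eq (Fintype.card_fin N))⟩,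
    by simp [Fin.ext_iff],
    fun i j hij => Finset.card_le_card fun n hn => by
      simp only [Finset.mem_filter, Finset.mem_univ, true_and] at hn ⊢
      exact le_trans hij hn⟩

/-- Queue lengths of the `N` servers in state `s`, the servers being listed in order of
non-increasing queue length. -/
def State.queues {N b : ℕ} (s : State N b) : Fin N → ℕ :=
  fun n => (Finset.univ.filter fun i : Fin b => (n : ℕ) < (s.1 i.succ : ℕ)).card

/-- `s.queues` is indeed a configuration of queue lengths whose state is `s`. -/
theorem toState_queues {N b : ℕ} (s : State N b) : toState b s.queues = s := by
  apply Subtype.ext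
  funext i
  apply Fin.ext
  have key : ∀ n : Fin N, ((i : ℕ) ≤ s.queues n ↔ (n : ℕ) < (s.1 i : ℕ)) := by
    intro n
    constructor
    · intro hi
      by_contra hn
      have hsub : (Finset.univ.filter fun j : Fin b => (n : ℕ) < (s.1 j.succ : ℕ)) ⊆
          Finset.univ.filter fun j : Fin b => (j : ℕ) + 1 < (i : ℕ) := by
        intro j hj
        simp only [Finset.mem_filter, Finset.mem_univ, true_and] at hj ⊢
        by_contra hji
        have h1 : i ≤ j.succ := by rw [Fin.le_def, Fin.val_succ]; omega
        have h2 : (s.1 j.succ : ℕ) ≤ (s.1 i : ℕ) := s.2.2 h1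
        omega
      have hpos : 0 < (i : ℕ) := by
        rcases Nat.eq_zero_or_pos (i : ℕ) with h0 | h0
        · have : i = 0 := Fin.ext h0
          rw [this, s.2.1] at hn
          simp at hn
        · exact h0
      have hc : (Finset.univ.filter fun j : Fin b => (j : ℕ) + 1 < (i : ℕ)).card ≤ (i : ℕ) - 1 := by
        have := Finset.card_le_card_of_injOn (s := Finset.univ.filter fun j : Fin b =>
          (j : ℕ) + 1 < (i : ℕ)) (t := Finset.range ((i : ℕ) - 1)) (fun j => (j : ℕ))
          (fun j hj => by simp at hj ⊢; omega) (fun a _ c _ hac => Fin.ext hac)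
        simpa using this
      have := hi.trans ((Finset.card_le_card hsub).trans hc)
      omega
    · intro hn
      have := Finset.card_le_card_of_injOn (s := (Finset.univ : Finset (Fin (i : ℕ))))
        (t := Finset.univ.filter fun j : Fin b => (n : ℕ) < (s.1 j.succ : ℕ))
        (fun j => ⟨(j : ℕ), by omega⟩)
        (fun j _ => by
          simp only [Finset.coe_filter, Finset.mem_univ, true_and, Set.mem_ofPred_eq]
          refine lt_of_lt_of_le hn (s.2.2 ?_)
          rw [Fin.le_def, Fin.val_succ]
          exact j.2)
        (fun a _ c _ hac => Fin.ext (by simpa using hac))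
      rw [Finset.card_univ, Fintype.card_fin] at this
      exact this
  change (Finset.univ.filter fun n : Fin N => (i : ℕ) ≤ s.queues n).card = (s.1 i : ℕ)
  simp only [key]
  have hle : (s.1 i : ℕ) ≤ N := by omega
  rw [Fin.card_filter_val_lt]
  omega

open scoped Classical in
/-- The transition rate of `S(t)` from `s` to `s'` for `N` servers with buffers of size `b`, load
`lam`, jobs of `k` tasks and `m` sampled queues per job. Every busy server completes a task at
rate `1`. Jobs arrive at rate `N * lam / k`; a job samples a uniformly random set `A` of `m`
queues and is admitted if no task is put into a queue that is full already, and it is dropped as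
a whole otherwise. -/
def rate (N b k m : ℕ) (lam : ℝ) (s s' : State N b) : ℝ :=
  ((Finset.univ.filter fun n : Fin N =>
      0 < s.queues n ∧ toState b (depart s.queues n) = s').card : ℝ) +
  (N : ℝ) * lam / k *
    ((((Finset.univ : Finset (Fin N)).powersetCard m).filter fun A =>
        (∀ n, batchFill A k s.queues n ≤ b) ∧
          toState b (batchFill A k s.queues) = s').card / (N.choose m : ℝ))

/-- `p` is a stationary distribution of the continuous-time Markov chain `S(t)`: a probability
vector that satisfies the global balance equations. -/
structure IsStationary (N b k m : ℕ) (lam : ℝ) (p : State N b → ℝ) : Prop where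
  nonneg : ∀ s, 0 ≤ p s
  sum_eq_one : ∑ s, p s = 1
  balance : ∀ s, p s * ∑ s' ∈ Finset.univ.erase s, rate N b k m lam s s' =
    ∑ s' ∈ Finset.univ.erase s, p s' * rate N b k m lam s' s

/-- The load `1 - β N^{-α}`. -/
def load (α β : ℝ) (N : ℕ) : ℝ := 1 - β * (N : ℝ) ^ (-α)

/-- The buffer size `min {N^α, N^{1/2-α} / k}`, rounded down to an integer. -/
def bufferSize (α : ℝ) (N k : ℕ) : ℕ :=
  ⌊min ((N : ℝ) ^ α) ((N : ℝ) ^ (1 / 2 - α) / k)⌋₊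

end

end BatchFilling

/-! Under the stationary law, a function whose drift is at most `-κ F + c` has mean at most `c / κ`
(`IsStationary.sum_mul_le`). It therefore suffices to find an exponential Lyapunov function of the
queue lengths with geometric drift. Put `E = ε H N` with `H ≈ h`. Let `z` be the number of tasks
above level `H` and `y` the number of free positions up to level `H`, so that the number of tasks is
`z - y + N H`. The Lyapunov function is `U + V`, with `U = exp (τ z)` and `V = U * exp (τ (3/4 E -
y))`, the latter being an exponential of the shifted number of tasks. If `y ≤ 7/8 E`, at most `7/8 N
ε` servers idle, since each idle server leaves `H` positions free. Service then outpaces arrivals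
and `V` decreases. If `y ≥ 5/8 E`, a sample holds at least `4 k` free positions on average. By a
Chernoff bound for sampling without replacement, based on Maclaurin's inequality, a job almost never
reaches above `H`, so `U` decreases up to a constant. The two ranges overlap. Outside the overlap
the uncontrolled term is smaller than the other by the factor `ρ = exp (-τ E / 8)` and is absorbed.
The stationary mean of `U + V` is thus at most `8`, and `x ≤ exp x` turns this into the bound on the
positive part. Taking `τ = log N / √N` gives the theorem. -/

namespace BatchFilling

/-! ### Stationarity and the drift of functions of the queue lengths -/

/-- Against a stationary distribution, the generator of the chain integrates every function
to zero. -/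
theorem IsStationary.sum_generator_eq_zero {N b k m : ℕ} {lam : ℝ} {p : State N b → ℝ}
    (hp : IsStationary N b k m lam p) (f : State N b → ℝ) :
    ∑ s, p s * ∑ s', rate N b k m lam s s' * (f s' - f s) = 0 := by
  have hbal : ∀ s, p s * ∑ s', rate N b k m lam s s' = ∑ s', p s' * rate N b k m lam s' s := by
    intro s
    rw [← Finset.add_sum_erase _ _ (Finset.mem_univ s),
      ← Finset.add_sum_erase _ (fun s' => p s' * rate N b k m lam s' s) (Finset.mem_univ s),
      mul_add, hp.balance s]
  have h1 : ∑ s, p s * ∑ s', rate N b k m lam s s' * f s'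
      = ∑ s, f s * ∑ s', p s' * rate N b k m lam s' s := by
    simp only [Finset.mul_sum]
    rw [Finset.sum_comm]
    refine Finset.sum_congr rfl fun s _ => Finset.sum_congr rfl fun s' _ => by ring
  have h2 : ∑ s, p s * ∑ s', rate N b k m lam s s' * f s
      = ∑ s, f s * (p s * ∑ s', rate N b k m lam s s') := by
    refine Finset.sum_congr rfl fun s _ => ?_
    rw [← Finset.sum_mul]
    ring
  simp only [mul_sub, Finset.sum_sub_distrib]
  rw [h1, h2]
  simp only [hbal, sub_self]

/-- A sum over all values, weighted with the sizes of the fibres, is a sum over the source. -/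
theorem sum_card_fiber_mul {ι σ : Type*} [Fintype σ] [DecidableEq σ] (S : Finset ι)
    (P : ι → Prop) [DecidablePred P] (F : ι → σ) (g : σ → ℝ) :
    ∑ s, ((S.filter fun i => P i ∧ F i = s).card : ℝ) * g s = ∑ i ∈ S.filter P, g (F i) := by
  have h1 : ∀ s, ((S.filter fun i => P i ∧ F i = s).card : ℝ) * g s
      = ∑ i ∈ S.filter P, if F i = s then g s else 0 := by
    intro s
    rw [← Finset.sum_filter, Finset.filter_filter, Finset.sum_const, nsmul_eq_mul]
  simp only [h1]
  rw [Finset.sum_comm]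
  simp

open scoped Classical in
/-- The drift of a function `F` of the queue lengths: its expected rate of change under departures
and under admitted arrivals. -/
noncomputable def drift {N : ℕ} (b k m : ℕ) (lam : ℝ) (F : (Fin N → ℕ) → ℝ)
    (q : Fin N → ℕ) : ℝ :=
  ∑ n ∈ Finset.univ.filter (fun n => 0 < q n), (F (depart q n) - F q) +
    (N : ℝ) * lam / k *
      ((∑ A ∈ ((Finset.univ : Finset (Fin N)).powersetCard m).filter
          (fun A => ∀ n, batchFill A k q n ≤ b), (F (batchFill A k q) - F q)) / (N.choose m : ℝ))

theorem State.queues_le {N b : ℕ} (s : State N b) (n : Fin N) : s.queues n ≤ b :=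
  (Finset.card_le_univ _).trans_eq (Fintype.card_fin b)

theorem depart_le {N : ℕ} (q : Fin N → ℕ) (n i : Fin N) : depart q n i ≤ q i := by
  unfold depart
  rcases eq_or_ne i n with rfl | h
  · simp
  · simp [h]

/-- The generator acts on states, the drift on queue lengths; `hF` lets `F` pass through the sorted
representative. Lengths up to `b` suffice there, as departures lower the queues and admitted jobs
respect the buffers. -/
theorem IsStationary.sum_drift_eq_zero {N b k m : ℕ} {lam : ℝ} {p : State N b → ℝ}
    (hp : IsStationary N b k m lam p) (F : (Fin N → ℕ) → ℝ)
    (hF : ∀ q : Fin N → ℕ, (∀ n, q n ≤ b) → F (toState b q).queues = F q) :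
    ∑ s, p s * drift b k m lam F s.queues = 0 := by
  classical
  rw [← hp.sum_generator_eq_zero fun s => F s.queues]
  refine Finset.sum_congr rfl fun s _ => ?_
  congr 1
  simp only [rate, add_mul, Finset.sum_add_distrib]
  unfold drift
  congr 1
  · rw [sum_card_fiber_mul]
    refine Finset.sum_congr rfl fun n _ => ?_
    rw [hF _ fun i => (depart_le _ _ _).trans (s.queues_le i)]
  · have := sum_card_fiber_mul ((Finset.univ : Finset (Fin N)).powersetCard m)
      (fun A => ∀ n, batchFill A k s.queues n ≤ b) (fun A => toState b (batchFill A k s.queues))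
      (fun s' => F s'.queues - F s.queues)
    have h2 : ∑ A ∈ ((Finset.univ : Finset (Fin N)).powersetCard m).filter
          (fun A => ∀ n, batchFill A k s.queues n ≤ b), (F (batchFill A k s.queues) - F s.queues)
        = ∑ A ∈ ((Finset.univ : Finset (Fin N)).powersetCard m).filter
          (fun A => ∀ n, batchFill A k s.queues n ≤ b),
            (F (toState b (batchFill A k s.queues)).queues - F s.queues) :=
      Finset.sum_congr rfl fun A hA => by rw [hF _ (Finset.mem_filter.1 hA).2]
    rw [h2, ← this, Finset.sum_div, Finset.mul_sum]
    refine Finset.sum_congr rfl fun s' _ => by ring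

/-! ### Symmetric sums depend on the state only -/

/-- A symmetric sum over bounded queue lengths, expressed through the tail counts. -/
theorem sum_comp_eq_sum_card {N b : ℕ} (q : Fin N → ℕ) (hq : ∀ n, q n ≤ b) (g : ℕ → ℝ) :
    ∑ n, g (q n) = N * g 0 + ∑ i ∈ Finset.range b,
      (g (i + 1) - g i) * ((Finset.univ.filter fun n => i + 1 ≤ q n).card : ℝ) := by
  have h1 : ∀ n, g (q n) = g 0 + ∑ i ∈ Finset.range b,
      (g (i + 1) - g i) * (if i + 1 ≤ q n then 1 else 0) := by
    intro n
    have h2 : ∑ i ∈ Finset.range b, (g (i + 1) - g i) * (if i + 1 ≤ q n then 1 else 0)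
        = ∑ i ∈ Finset.range (q n), (g (i + 1) - g i) := by
      simp only [mul_ite, mul_one, mul_zero]
      rw [← Finset.sum_filter]
      refine Finset.sum_congr ?_ fun _ _ => rfl
      ext i
      have := hq n
      simp only [Finset.mem_filter, Finset.mem_range]
      omega
    rw [h2, Finset.sum_range_sub]
    ring
  rw [Finset.sum_congr rfl fun n _ => h1 n, Finset.sum_add_distrib, Finset.sum_comm,
    Finset.sum_const, Finset.card_univ, Fintype.card_fin, nsmul_eq_mul]
  congr 1
  refine Finset.sum_congr rfl fun i _ => ?_
  rw [← Finset.mul_sum, Finset.sum_boole]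

theorem sum_queues_toState {N b : ℕ} (q : Fin N → ℕ) (hq : ∀ n, q n ≤ b) (g : ℕ → ℝ) :
    ∑ n, g ((toState b q).queues n) = ∑ n, g (q n) := by
  rw [sum_comp_eq_sum_card _ (State.queues_le _) g, sum_comp_eq_sum_card q hq g]
  congr 1
  refine Finset.sum_congr rfl fun i hi => ?_
  congr 2
  have hs := congrArg (fun s : State N b =>
    ((s.1 ⟨i + 1, by have := Finset.mem_range.1 hi; omega⟩ : Fin (N + 1)) : ℕ))
    (toState_queues (toState b q))
  exact hs

theorem State.total_eq {N b : ℕ} (s : State N b) :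
    s.total = (∑ n, (s.queues n : ℝ)) / N := by
  have h := sum_comp_eq_sum_card s.queues s.queues_le fun i => (i : ℝ)
  rw [h, State.total]
  simp only [Nat.cast_zero, mul_zero, zero_add, Nat.cast_add, Nat.cast_one, add_sub_cancel_left,
    one_mul, Finset.sum_div]
  rw [← Fin.sum_univ_eq_sum_range
    (fun i => ((Finset.univ.filter fun n => i + 1 ≤ s.queues n).card : ℝ) / (N : ℝ))]
  refine Finset.sum_congr rfl fun i _ => ?_
  unfold State.frac
  congr 2
  exact (congrArg (fun s : State N b => ((s.1 i.succ : Fin (N + 1)) : ℕ)) (toState_queues s)).symm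

/-! ### Effect of one job or one departure on task count and excess -/

/-- The number of tasks at positions above level `H`. -/
def excess {N : ℕ} (H : ℕ) (q : Fin N → ℕ) : ℕ := ∑ n, (q n - H)

/-- Both sides are sums, so that `omega` can use it with the truncated functions `i - H` and `H -
i`. -/
theorem sum_comp_update {ι : Type*} [DecidableEq ι] (S : Finset ι) (g : ℕ → ℕ) (q : ι → ℕ)
    {n : ι} (hn : n ∈ S) (v : ℕ) :
    ∑ i ∈ S, g (Function.update q n v i) + g (q n) = ∑ i ∈ S, g (q i) + g v := by
  rw [← Finset.add_sum_erase _ _ hn, ← Finset.add_sum_erase S (fun i => g (q i)) hn]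
  have : ∑ i ∈ S.erase n, g (Function.update q n v i) = ∑ i ∈ S.erase n, g (q i) :=
    Finset.sum_congr rfl fun i hi => by
      rw [Function.update_of_ne (Finset.ne_of_mem_erase hi)]
  rw [this, Function.update_self]
  ring

theorem joinShortest_eq {N : ℕ} {A : Finset (Fin N)} (hA : A.Nonempty) (q : Fin N → ℕ) :
    ∃ n ∈ A, (∀ j ∈ A, q n ≤ q j) ∧ joinShortest A q = Function.update q n (q n + 1) := by
  have h := (A.exists_min_image q hA).choose_spec
  refine ⟨_, h.1, h.2, ?_⟩
  simp only [joinShortest, dif_pos hA]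

theorem sum_joinShortest_le {N : ℕ} (A : Finset (Fin N)) (q : Fin N → ℕ) :
    ∑ n, joinShortest A q n ≤ ∑ n, q n + 1 := by
  rcases A.eq_empty_or_nonempty with rfl | hA
  · simp [joinShortest]
  · obtain ⟨n, -, -, h⟩ := joinShortest_eq hA q
    have := sum_comp_update Finset.univ id q (Finset.mem_univ n) (q n + 1)
    simp only [id] at this
    rw [h]
    omega

theorem excess_joinShortest_le {N : ℕ} (H : ℕ) (A : Finset (Fin N)) (q : Fin N → ℕ) :
    excess H (joinShortest A q) ≤ excess H q + 1 := by
  rcases A.eq_empty_or_nonempty with rfl | hA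
  · simp [joinShortest]
  · obtain ⟨n, -, -, h⟩ := joinShortest_eq hA q
    have := sum_comp_update Finset.univ (fun i => i - H) q (Finset.mem_univ n) (q n + 1)
    rw [h]
    unfold excess
    omega

theorem sum_batchFill_le {N : ℕ} (A : Finset (Fin N)) (k : ℕ) (q : Fin N → ℕ) :
    ∑ n, batchFill A k q n ≤ ∑ n, q n + k := by
  induction k generalizing q with
  | zero => simp [batchFill]
  | succ k ih =>
    have h1 := ih (joinShortest A q)
    have h2 := sum_joinShortest_le A q
    simp only [batchFill]
    omega

theorem excess_batchFill_le {N : ℕ} (H : ℕ) (A : Finset (Fin N)) (k : ℕ) (q : Fin N → ℕ) :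
    excess H (batchFill A k q) ≤ excess H q + k := by
  induction k generalizing q with
  | zero => simp [batchFill]
  | succ k ih =>
    have h1 := ih (joinShortest A q)
    have h2 := excess_joinShortest_le H A q
    simp only [batchFill]
    omega

/-- If the sampled queues have room for all tasks below level `H`, then no task is put above
level `H`. -/
theorem excess_batchFill_of_le {N : ℕ} (H : ℕ) (A : Finset (Fin N)) (k : ℕ) (q : Fin N → ℕ)
    (hk : k ≤ ∑ n ∈ A, (H - q n)) : excess H (batchFill A k q) = excess H q := by
  induction k generalizing q with
  | zero => simp [batchFill]
  | succ k ih =>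
    have hA : A.Nonempty := by
      rw [Finset.nonempty_iff_ne_empty]
      rintro rfl
      simp at hk
    obtain ⟨n, hnA, hmin, h⟩ := joinShortest_eq hA q
    -- If a shortest sampled queue reached `H`, the whole sample would have no room below `H`.
    have hn : q n < H := by
      by_contra hcon
      have : ∑ n ∈ A, (H - q n) = 0 := Finset.sum_eq_zero fun j hj => by
        have := hmin j hj
        omega
      omega
    have h1 := sum_comp_update A (fun i => H - i) q hnA (q n + 1)
    have h2 := sum_comp_update Finset.univ (fun i => i - H) q (Finset.mem_univ n) (q n + 1)
    simp only [batchFill]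
    rw [ih _ (by rw [h]; omega), h]
    unfold excess
    omega

theorem sum_depart {N : ℕ} (q : Fin N → ℕ) {n : Fin N} (hn : 0 < q n) :
    ∑ i, depart q n i + 1 = ∑ i, q i := by
  have := sum_comp_update Finset.univ id q (Finset.mem_univ n) (q n - 1)
  simp only [id] at this
  unfold depart
  omega

theorem excess_depart {N : ℕ} {H : ℕ} (q : Fin N → ℕ) {n : Fin N} (hn : H < q n) :
    excess H (depart q n) + 1 = excess H q := by
  have := sum_comp_update Finset.univ (fun i => i - H) q (Finset.mem_univ n) (q n - 1)
  unfold depart excess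
  omega

theorem excess_mono {N : ℕ} (H : ℕ) {q q' : Fin N → ℕ} (h : q ≤ q') : excess H q ≤ excess H q' :=
  Finset.sum_le_sum fun n _ => Nat.sub_le_sub_right (h n) H

/-! ### Drift of exponential functions -/

theorem exp_le_one_add_add_sq {u : ℝ} (h0 : 0 ≤ u) (h1 : u ≤ 1) : Real.exp u ≤ 1 + u + u ^ 2 := by
  have := Real.abs_exp_sub_one_sub_id_le (x := u) (by rw [abs_of_nonneg h0]; exact h1)
  have := (abs_le.1 this).2
  linarith

/-- Drift bound for an exponential function `exp ∘ φ`: departures from the servers in `D`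
decrease `φ` by `τ`, and a sample outside of `B` does not increase it. -/
theorem drift_exp_le {N b k m : ℕ} {lam τ r : ℝ} (hlam : 0 ≤ lam) (hk : 0 < k) (hm : m ≤ N)
    (hτ : 0 ≤ τ) (hτk : τ * k ≤ 1) (φ : (Fin N → ℕ) → ℝ) (q : Fin N → ℕ)
    (D : Finset (Fin N)) (hD : ∀ n ∈ D, 0 < q n ∧ φ (depart q n) = φ q - τ)
    (hdep : ∀ n, φ (depart q n) ≤ φ q)
    (harr : ∀ A, φ (batchFill A k q) ≤ φ q + τ * k)
    (B : Finset (Finset (Fin N)))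
    (hB : ∀ A ∈ (Finset.univ : Finset (Fin N)).powersetCard m, A ∉ B → φ (batchFill A k q) ≤ φ q)
    (hBr : (B.card : ℝ) ≤ N.choose m * r) :
    drift b k m lam (fun q => Real.exp (φ q)) q
      ≤ Real.exp (φ q) * (τ * (N * lam * (1 + τ * k) * r - D.card * (1 - τ))) := by
  classical
  set S := ((Finset.univ : Finset (Fin N)).powersetCard m).filter
    (fun A => ∀ n, batchFill A k q n ≤ b) with hS
  have hk' : (0 : ℝ) < k := by exact_mod_cast hk
  have hk1 : (1 : ℝ) ≤ k := by exact_mod_cast hk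
  have hE := Real.exp_pos (φ q)
  have hC : (0 : ℝ) < N.choose m := by exact_mod_cast Nat.choose_pos hm
  have hτ1 : τ ≤ 1 := (le_mul_of_one_le_right hτ hk1).trans hτk
  have h1 : ∑ n ∈ Finset.univ.filter (fun n => 0 < q n),
      (Real.exp (φ (depart q n)) - Real.exp (φ q))
        ≤ -(Real.exp (φ q) * (τ * (D.card * (1 - τ)))) := by
    calc _ ≤ ∑ n ∈ D, (Real.exp (φ (depart q n)) - Real.exp (φ q)) := by
          -- After negation all terms are nonnegative, so departures outside `D` may be discarded.
          rw [← neg_le_neg_iff, ← Finset.sum_neg_distrib, ← Finset.sum_neg_distrib]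
          refine Finset.sum_le_sum_of_subset_of_nonneg
            (fun n hn => Finset.mem_filter.2 ⟨Finset.mem_univ n, (hD n hn).1⟩) fun n _ _ => ?_
          have := Real.exp_le_exp.2 (hdep n)
          linarith
      _ ≤ ∑ n ∈ D, -(Real.exp (φ q) * (τ * (1 - τ))) := by
          refine Finset.sum_le_sum fun n hn => ?_
          rw [(hD n hn).2, sub_eq_add_neg (φ q), Real.exp_add]
          have h2 : Real.exp (-τ) ≤ 1 - τ + τ ^ 2 := by
            have := Real.abs_exp_sub_one_sub_id_le (x := -τ)
              (by rw [abs_neg, abs_of_nonneg hτ]; exact hτ1)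
            have := (abs_le.1 this).2
            nlinarith
          nlinarith
      _ = _ := by
          rw [Finset.sum_const, nsmul_eq_mul]
          ring
  -- The factor `k` on the right cancels the `1 / k` in the job arrival rate; `1 + τ k` is the
  -- second-order loss.
  have hexp : Real.exp (τ * k) - 1 ≤ τ * k * (1 + τ * k) := by
    have := exp_le_one_add_add_sq (by positivity) hτk
    nlinarith
  have hexp0 : 0 ≤ Real.exp (τ * k) - 1 := by
    have := Real.one_le_exp (show 0 ≤ τ * k by positivity)
    linarith
  have h2 : ∑ A ∈ S,
          (Real.exp (φ (batchFill A k q)) - Real.exp (φ q))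
      ≤ (N.choose m * r) * (Real.exp (φ q) * (τ * k * (1 + τ * k))) := by
    calc _ ≤ ∑ A ∈ S,
          (if A ∈ B then Real.exp (φ q) * (Real.exp (τ * k) - 1) else 0) := by
          refine Finset.sum_le_sum fun A hA => ?_
          split_ifs with hAB
          · have := Real.exp_le_exp.2 (harr A)
            rw [Real.exp_add] at this
            linarith
          · have := Real.exp_le_exp.2 (hB A (Finset.mem_filter.1 hA).1 hAB)
            linarith
      _ ≤ ∑ A ∈ B, Real.exp (φ q) * (Real.exp (τ * k) - 1) := by
          rw [← Finset.sum_filter]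
          refine Finset.sum_le_sum_of_subset_of_nonneg
            (fun A hA => (Finset.mem_filter.1 hA).2) fun A _ _ => by positivity
      _ = B.card * (Real.exp (φ q) * (Real.exp (τ * k) - 1)) := by
          rw [Finset.sum_const, nsmul_eq_mul]
      _ ≤ _ := mul_le_mul hBr (by gcongr) (by positivity) ((Nat.cast_nonneg _).trans hBr)
  have h3 : (N : ℝ) * lam / k * ((∑ A ∈ S,
          (Real.exp (φ (batchFill A k q)) - Real.exp (φ q))) / (N.choose m : ℝ))
      ≤ Real.exp (φ q) * (τ * (N * lam * (1 + τ * k) * r)) := by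
    calc _ ≤ (N : ℝ) * lam / k *
          ((N.choose m * r) * (Real.exp (φ q) * (τ * k * (1 + τ * k))) / (N.choose m : ℝ)) := by
          gcongr
      _ = _ := by field_simp
  have h4 := add_le_add h1 h3
  unfold drift
  refine h4.trans (le_of_eq ?_)
  ring

/-! ### Sampling without replacement -/

/-- **Maclaurin's inequality** between an elementary symmetric mean and the arithmetic mean. -/
theorem sum_powersetCard_prod_le {ι : Type*} [DecidableEq ι] (S : Finset ι) (x : ι → ℝ)
    (hx : ∀ i, 0 ≤ x i) (m : ℕ) :
    ∑ A ∈ S.powersetCard m, ∏ i ∈ A, x i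
      ≤ (S.card.choose m : ℝ) * ((∑ i ∈ S, x i) / S.card) ^ m := by
  induction S using Finset.induction_on generalizing m with
  | empty =>
    rcases m with _ | m
    · simp
    · rw [Finset.powersetCard_eq_empty.2 (by simp)]
      simp
  | insert a S ha ih =>
    rcases m with _ | m
    · simp
    rw [Finset.powersetCard_succ_insert ha, Finset.sum_union, Finset.sum_image,
      Finset.card_insert_of_notMem ha, Finset.sum_insert ha]
    · have hprod : ∀ A ∈ S.powersetCard m, ∏ i ∈ insert a A, x i = x a * ∏ i ∈ A, x i := by
        intro A hA
        rw [Finset.prod_insert fun h => ha ((Finset.mem_powersetCard.1 hA).1 h)]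
      rw [Finset.sum_congr rfl hprod, ← Finset.mul_sum]
      set n := S.card with hn
      set μ := (∑ i ∈ S, x i) / n with hμ
      have hμ0 : 0 ≤ μ := div_nonneg (Finset.sum_nonneg fun i _ => hx i) (Nat.cast_nonneg n)
      have hsum : ∑ i ∈ S, x i = n * μ := by
        rcases Nat.eq_zero_or_pos n with h0 | h0
        · have : S = ∅ := Finset.card_eq_zero.1 (hn ▸ h0)
          rw [h0, this, Finset.sum_empty, Nat.cast_zero, zero_mul]
        · rw [hμ]
          field_simp
      have hn1 : (0 : ℝ) < (n : ℝ) + 1 := Nat.cast_add_one_pos n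
      have e1 : ((n.choose (m + 1) : ℝ) + n.choose m) = ((n + 1).choose (m + 1) : ℕ) := by
        rw [Nat.choose_succ_succ]
        push_cast
        ring
      have e2 : ((n : ℝ) + 1) * n.choose m = (n + 1).choose (m + 1) * ((m : ℝ) + 1) := by
        exact_mod_cast Nat.add_one_mul_choose_eq n m
      set C : ℝ := (((n + 1).choose (m + 1) : ℕ) : ℝ) with hC
      have e3 : (n.choose m : ℝ) = C * (m + 1) / (n + 1) := by
        rw [← e2]
        field_simp
      have hC0 : 0 ≤ C := Nat.cast_nonneg _
      -- Adding `x a` moves the mean from `μ` to `μ + (x a - μ) / (n + 1)`. After Pascal's rule the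
      -- induction step is Bernoulli's inequality scaled by `μ ^ (m + 1)`, which needs `μ = 0`
      -- apart.
      have hbern : μ ^ (m + 1) + (m + 1) * ((x a - μ) / (n + 1)) * μ ^ m
          ≤ (μ + (x a - μ) / (n + 1)) ^ (m + 1) := by
        rcases hμ0.eq_or_lt with h0 | h0
        · rw [← h0]
          rcases m with _ | m
          · simp
          · have : 0 ≤ x a / ((n : ℝ) + 1) := div_nonneg (hx a) hn1.le
            simp only [ne_eq, Nat.add_eq_zero_iff, one_ne_zero, and_false, not_false_eq_true,
              zero_pow, sub_zero, zero_add, mul_zero]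
            positivity
        · have hb := one_add_mul_le_pow (a := (x a - μ) / (n + 1) / μ) (by
            rw [le_div_iff₀ h0, le_div_iff₀ hn1]
            have : 0 ≤ (n : ℝ) * μ := mul_nonneg (Nat.cast_nonneg n) hμ0
            nlinarith [hx a]) (m + 1)
          have h2 := mul_le_mul_of_nonneg_left hb (pow_nonneg hμ0 (m + 1))
          rw [← mul_pow] at h2
          have h3 : μ * (1 + (x a - μ) / (n + 1) / μ) = μ + (x a - μ) / (n + 1) := by
            field_simp
          rw [h3] at h2
          refine le_trans (le_of_eq ?_) h2
          push_cast
          field_simp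
          ring
      have e4 : (x a + ∑ i ∈ S, x i) / ((n + 1 : ℕ) : ℝ) = μ + (x a - μ) / (n + 1) := by
        rw [hsum]
        push_cast
        field_simp
        ring
      rw [e4]
      calc _ ≤ (n.choose (m + 1) : ℝ) * μ ^ (m + 1) + x a * (n.choose m * μ ^ m) :=
            add_le_add (ih _) (mul_le_mul_of_nonneg_left (ih _) (hx a))
        _ = C * (μ ^ (m + 1) + (m + 1) * ((x a - μ) / (n + 1)) * μ ^ m) := by
            have : (n.choose (m + 1) : ℝ) = C - n.choose m := by linarith
            rw [this, e3]
            field_simp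
            ring
        _ ≤ _ := mul_le_mul_of_nonneg_left hbern hC0
    · intro A hA B hB hAB
      have hA' : a ∉ A := fun h => ha ((Finset.mem_powersetCard.1 (Finset.mem_coe.1 hA)).1 h)
      have hB' : a ∉ B := fun h => ha ((Finset.mem_powersetCard.1 (Finset.mem_coe.1 hB)).1 h)
      rw [← Finset.erase_insert hA', ← Finset.erase_insert hB']
      exact congrArg (fun T => T.erase a) hAB
    · rw [Finset.disjoint_left]
      intro A hA hA'
      obtain ⟨B, _, rfl⟩ := Finset.mem_image.1 hA'
      exact ha ((Finset.mem_powersetCard.1 hA).1 (Finset.mem_insert_self a B))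

/-- A Chernoff bound for sampling without replacement: if the weights `a n ∈ [0, H]` have sampling
mean at least `4 * k`, few samples have total weight below `k`. -/
theorem card_sample_lt_le {N : ℕ} (hN : 0 < N) (H k m : ℕ) (hH : 0 < H) (a : Fin N → ℕ)
    (ha : ∀ n, a n ≤ H) (hmean : (4 * k : ℝ) ≤ m * ((∑ n, (a n : ℝ)) / N)) :
    ((((Finset.univ : Finset (Fin N)).powersetCard m).filter
        fun A => ∑ n ∈ A, a n < k).card : ℝ) ≤ N.choose m * Real.exp (-(k / H : ℝ)) := by
  have hH' : (0 : ℝ) < H := by exact_mod_cast hH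
  have hN' : (0 : ℝ) < N := by exact_mod_cast hN
  set x : Fin N → ℝ := fun n => Real.exp (-(a n / H : ℝ)) with hxdef
  have hx : ∀ n, 0 ≤ x n := fun n => (Real.exp_pos _).le
  have hx1 : ∀ n, x n ≤ 1 - a n / (2 * H) := by
    intro n
    have h0 : (0 : ℝ) ≤ a n / H := by positivity
    have h1 : (a n / H : ℝ) ≤ 1 := by
      rw [div_le_one hH']
      exact_mod_cast ha n
    have e : (a n : ℝ) / (2 * H) = (a n / H) / 2 := by field_simp
    rw [e, hxdef]
    set u : ℝ := a n / H
    show Real.exp (-u) ≤ 1 - u / 2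
    rw [Real.exp_neg]
    have h2 := Real.add_one_le_exp u
    -- On `[0, 1]`, `(1 + u) (1 - u / 2) = 1 + u (1 - u) / 2 ≥ 1`.
    have h3 : (u + 1)⁻¹ ≤ 1 - u / 2 := by
      rw [inv_le_iff_one_le_mul₀ (by linarith)]
      nlinarith
    exact (inv_anti₀ (by linarith) h2).trans h3
  have hmac := sum_powersetCard_prod_le Finset.univ x hx m
  rw [Finset.card_univ, Fintype.card_fin] at hmac
  have hmu0 : 0 ≤ (∑ n, x n) / N := div_nonneg (Finset.sum_nonneg fun n _ => hx n) hN'.le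
  set Y : ℝ := (∑ n, (a n : ℝ)) / N with hY
  have hmu : (∑ n, x n) / N ≤ Real.exp (-(Y / (2 * H))) := by
    have h1 : (∑ n, x n) ≤ ∑ n, (1 - (a n : ℝ) / (2 * H)) := Finset.sum_le_sum fun n _ => hx1 n
    rw [Finset.sum_sub_distrib, ← Finset.sum_div] at h1
    simp only [Finset.sum_const, Finset.card_univ, Fintype.card_fin, nsmul_eq_mul, mul_one] at h1
    have h2 := Real.add_one_le_exp (-(Y / (2 * H)))
    refine le_trans ?_ h2
    rw [div_le_iff₀ hN']
    have : (-(Y / (2 * H)) + 1) * N = N - (∑ n, (a n : ℝ)) / (2 * H) := by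
      rw [hY]
      field_simp
      ring
    linarith
  have hpow : ((∑ n, x n) / N) ^ m ≤ Real.exp (-(2 * k / H)) := by
    refine (pow_le_pow_left₀ hmu0 hmu m).trans ?_
    rw [← Real.exp_nat_mul]
    refine Real.exp_le_exp.2 ?_
    have : (4 * k : ℝ) / (2 * H) ≤ m * Y / (2 * H) := by gcongr
    have e1 : (m : ℝ) * (-(Y / (2 * H))) = -(m * Y / (2 * H)) := by ring
    have e2 : (4 * k : ℝ) / (2 * H) = 2 * k / H := by
      field_simp
      ring
    rw [e1]
    linarith
  -- Markov's inequality: each light sample contributes at least `exp (-k / H)` to the symmetric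
  -- sum. Dividing by this leaves one of the two factors `exp (-k / H)` in `hpow`.
  have hmark : ((((Finset.univ : Finset (Fin N)).powersetCard m).filter
        fun A => ∑ n ∈ A, a n < k).card : ℝ) * Real.exp (-(k / H : ℝ))
      ≤ ∑ A ∈ (Finset.univ : Finset (Fin N)).powersetCard m, ∏ i ∈ A, x i := by
    rw [← nsmul_eq_mul, ← Finset.sum_const]
    refine (Finset.sum_le_sum fun A hA => ?_).trans
      (Finset.sum_le_sum_of_subset_of_nonneg (Finset.filter_subset _ _)
        fun A _ _ => Finset.prod_nonneg fun i _ => hx i)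
    rw [hxdef, ← Real.exp_sum]
    refine Real.exp_le_exp.2 ?_
    rw [Finset.sum_neg_distrib, ← Finset.sum_div]
    have : (∑ n ∈ A, (a n : ℝ)) ≤ k := by exact_mod_cast (Finset.mem_filter.1 hA).2.le
    gcongr
  have hE := Real.exp_pos (-(k / H : ℝ))
  have e : Real.exp (-(2 * k / H : ℝ)) = Real.exp (-(k / H : ℝ)) * Real.exp (-(k / H : ℝ)) := by
    rw [← Real.exp_add]
    congr 1
    ring
  refine le_of_mul_le_mul_right ?_ hE
  calc _ ≤ _ := hmark
    _ ≤ _ := hmac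
    _ ≤ N.choose m * Real.exp (-(2 * k / H)) := by gcongr
    _ = _ := by rw [e]; ring

/-! ### Deficit, and the drifts of the two exponentials -/

/-- The number of free positions up to level `H`. -/
def deficit {N : ℕ} (H : ℕ) (q : Fin N → ℕ) : ℕ := ∑ n, (H - q n)

theorem sum_add_deficit {N : ℕ} (H : ℕ) (q : Fin N → ℕ) :
    ∑ n, q n + deficit H q = excess H q + N * H := by
  have : N * H = ∑ _n : Fin N, H := by simp
  rw [this]
  unfold deficit excess
  rw [← Finset.sum_add_distrib, ← Finset.sum_add_distrib]
  exact Finset.sum_congr rfl fun n _ => by omega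

/-- Every idle server contributes `H` free positions. -/
theorem mul_card_idle_le_deficit {N : ℕ} (H : ℕ) (q : Fin N → ℕ) :
    H * (N - (Finset.univ.filter fun n => 0 < q n).card : ℝ) ≤ deficit H q := by
  have h1 : (Finset.univ.filter fun n => 0 < q n).card + (Finset.univ.filter fun n => q n = 0).card
      = N := by
    have := Finset.card_filter_add_card_filter_not (s := (Finset.univ : Finset (Fin N)))
      (fun n => 0 < q n)
    simpa using this
  have h2 : (N - (Finset.univ.filter fun n => 0 < q n).card : ℝ)
      = ((Finset.univ.filter fun n => q n = 0).card : ℝ) := by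
    have : (((Finset.univ.filter fun n => 0 < q n).card : ℝ) +
      (Finset.univ.filter fun n => q n = 0).card) = N := by exact_mod_cast h1
    linarith
  rw [h2]
  have h3 : H * (Finset.univ.filter fun n => q n = 0).card ≤ deficit H q := by
    calc _ = ∑ n ∈ Finset.univ.filter fun n => q n = 0, H := by
          rw [Finset.sum_const, smul_eq_mul, mul_comm]
      _ = ∑ n ∈ Finset.univ.filter fun n => q n = 0, (H - q n) :=
          Finset.sum_congr rfl fun n hn => by rw [(Finset.mem_filter.1 hn).2]; rfl
      _ ≤ _ := Finset.sum_le_sum_of_subset (Finset.filter_subset _ _)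
  exact_mod_cast h3

theorem drift_add {N : ℕ} (b k m : ℕ) (lam : ℝ) (F G : (Fin N → ℕ) → ℝ) (q : Fin N → ℕ) :
    drift b k m lam (fun q => F q + G q) q = drift b k m lam F q + drift b k m lam G q := by
  simp only [drift, add_sub_add_comm, Finset.sum_add_distrib, add_div, mul_add]
  ring

/-- Drift of the exponential of the number of tasks. -/
theorem drift_exp_sum_le {N b k m : ℕ} {lam τ : ℝ} (hlam : 0 ≤ lam) (hk : 0 < k) (hm : m ≤ N)
    (hτ : 0 ≤ τ) (hτk : τ * k ≤ 1) (c : ℝ) (q : Fin N → ℕ) :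
    drift b k m lam (fun q => Real.exp (τ * (∑ n, (q n : ℝ)) - c)) q
      ≤ Real.exp (τ * (∑ n, (q n : ℝ)) - c) * (τ * (N * lam * (1 + τ * k)
        - (Finset.univ.filter fun n => 0 < q n).card * (1 - τ))) := by
  have h := drift_exp_le (b := b) hlam hk hm hτ hτk (r := 1)
    (fun q => τ * (∑ n, (q n : ℝ)) - c) q (Finset.univ.filter fun n => 0 < q n)
    (fun n hn => by
      have hn := (Finset.mem_filter.1 hn).2
      refine ⟨hn, ?_⟩
      have h1 : (∑ i, (depart q n i : ℝ)) + 1 = ∑ i, (q i : ℝ) := by exact_mod_cast sum_depart q hn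
      rw [← h1]
      ring)
    (fun n => by
      have h1 : (∑ i, (depart q n i : ℝ)) ≤ ∑ i, (q i : ℝ) :=
        Finset.sum_le_sum fun i _ => Nat.cast_le.2 (depart_le q n i)
      have := mul_le_mul_of_nonneg_left h1 hτ
      linarith)
    (fun A => by
      have h1 : (∑ i, (batchFill A k q i : ℝ)) ≤ ∑ i, (q i : ℝ) + k := by
        exact_mod_cast sum_batchFill_le A k q
      have := mul_le_mul_of_nonneg_left h1 hτ
      linarith)
    -- Every sample may increase the number of tasks, hence all of them are put in `B` and `r = 1`.
    ((Finset.univ : Finset (Fin N)).powersetCard m) (fun A hA hA' => absurd hA hA')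
    (by simp)
  simpa only [mul_one] using h

/-- Drift of the exponential of the excess, when a fraction of at most `r` of the samples
lacks room below level `H`. -/
theorem drift_exp_excess_le {N b k m : ℕ} {lam τ r : ℝ} (H : ℕ) (hlam : 0 ≤ lam) (hk : 0 < k)
    (hm : m ≤ N) (hτ : 0 ≤ τ) (hτk : τ * k ≤ 1) (q : Fin N → ℕ)
    (hr : ((((Finset.univ : Finset (Fin N)).powersetCard m).filter
        fun A => ∑ n ∈ A, (H - q n) < k).card : ℝ) ≤ N.choose m * r) :
    drift b k m lam (fun q => Real.exp (τ * excess H q)) q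
      ≤ Real.exp (τ * excess H q) * (τ * (N * lam * (1 + τ * k) * r
        - (Finset.univ.filter fun n => H < q n).card * (1 - τ))) := by
  refine drift_exp_le (b := b) hlam hk hm hτ hτk
    (fun q => τ * excess H q) q (Finset.univ.filter fun n => H < q n)
    (fun n hn => ?_) (fun n => ?_) (fun A => ?_) _ (fun A hA hA' => ?_) hr
  · have hn := (Finset.mem_filter.1 hn).2
    refine ⟨by omega, ?_⟩
    have h1 : (excess H (depart q n) : ℝ) + 1 = excess H q := by exact_mod_cast excess_depart q hn
    rw [← h1]
    ring
  · have h1 : (excess H (depart q n) : ℝ) ≤ excess H q :=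
      Nat.cast_le.2 (excess_mono H (depart_le q n))
    exact mul_le_mul_of_nonneg_left h1 hτ
  · have h1 : (excess H (batchFill A k q) : ℝ) ≤ excess H q + k := by
      exact_mod_cast excess_batchFill_le H A k q
    have := mul_le_mul_of_nonneg_left h1 hτ
    linarith
  · have h1 : k ≤ ∑ n ∈ A, (H - q n) := by
      by_contra hcon
      exact hA' (Finset.mem_filter.2 ⟨hA, not_le.1 hcon⟩)
    rw [excess_batchFill_of_le H A k q h1]

/-! ### The Lyapunov function and its geometric drift -/

/-- The Lyapunov function: the exponential of the excess plus the exponential of the shifted number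
of tasks. -/
noncomputable def lyapunov {N : ℕ} (τ ε : ℝ) (H : ℕ) (q : Fin N → ℕ) : ℝ :=
  Real.exp (τ * excess H q) +
    Real.exp (τ * (∑ n, (q n : ℝ)) - τ * (N * H - 3 / 4 * (ε * H * N)))

theorem lyapunov_toState {N b : ℕ} (τ ε : ℝ) (H : ℕ) (q : Fin N → ℕ) (hq : ∀ n, q n ≤ b) :
    lyapunov τ ε H (toState b q).queues = lyapunov τ ε H q := by
  have h1 := sum_queues_toState q hq fun i => (i : ℝ)
  have h2 := sum_queues_toState q hq fun i => ((i - H : ℕ) : ℝ)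
  have h3 : (excess H (toState b q).queues : ℝ) = excess H q := by
    unfold excess
    push_cast
    exact h2
  unfold lyapunov
  rw [h3, h1]

set_option maxHeartbeats 1000000 in
/-- Geometric drift of the Lyapunov function. If the deficit is small, most servers are busy and
the number of tasks decreases; if it is large, the sampled queues have room below level `H` and the
excess decreases. -/
theorem drift_lyapunov_le {N b k m H : ℕ} {ε τ : ℝ} (hε0 : 0 < ε) (hε1 : ε ≤ 1) (hk : 0 < k)
    (hH : 0 < H) (hm : m ≤ N) (hτ : 0 < τ) (hN : 8 ≤ N) (hNε : 8 ≤ N * ε)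
    (hτk : τ * k ≤ ε / 32) (hmk : (4 * k : ℝ) ≤ m * (5 / 8 * (ε * H)))
    (hkH : Real.exp (-(k / H : ℝ)) ≤ 1 / (N : ℝ) ^ 2)
    (hρε : 64 * Real.exp (-(τ * (ε * H * N) / 8)) ≤ ε)
    (hρN : 16 * N * Real.exp (-(τ * (ε * H * N) / 8)) ≤ 1) (q : Fin N → ℕ) :
    drift b k m (1 - ε) (lyapunov τ ε H) q ≤ -(τ / 8) * lyapunov τ ε H q + τ := by
  have hN' : (8 : ℝ) ≤ N := by exact_mod_cast hN
  have hN0 : (0 : ℝ) < N := by linarith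
  have hk1 : (1 : ℝ) ≤ k := by exact_mod_cast hk
  have hH0 : (0 : ℝ) < H := by exact_mod_cast hH
  have hlam : 0 ≤ 1 - ε := by linarith
  have hτk1 : τ * k ≤ 1 := by linarith
  have hτ' : τ ≤ ε / 32 := (le_mul_of_one_le_right hτ.le hk1).trans hτk
  set E : ℝ := ε * H * N with hE
  have hE0 : 0 < E := by positivity
  set ρ := Real.exp (-(τ * E / 8)) with hρ
  have hρ0 : 0 < ρ := Real.exp_pos _
  set z : ℝ := ((excess H q : ℕ) : ℝ) with hz
  set y : ℝ := ((deficit H q : ℕ) : ℝ) with hy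
  have hbal : (∑ n, (q n : ℝ)) = z - y + N * H := by
    have h1 : (∑ n, (q n : ℝ)) + deficit H q = excess H q + N * H := by
      exact_mod_cast sum_add_deficit H q
    rw [hz, hy]
    linarith
  set U := Real.exp (τ * z) with hU
  set V := Real.exp (τ * (∑ n, (q n : ℝ)) - τ * (N * H - 3 / 4 * E)) with hV
  have hVU : V = U * Real.exp (τ * (3 / 4 * E - y)) := by
    rw [hV, hU, ← Real.exp_add, hbal]
    congr 1
    ring
  have hU0 : 0 < U := Real.exp_pos _
  have hV0 : 0 < V := Real.exp_pos _
  set B : ℝ := (((Finset.univ.filter fun n => 0 < q n).card : ℕ) : ℝ) with hB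
  have hidle : H * (N - B) ≤ y := mul_card_idle_le_deficit H q
  have hBN : B ≤ N := by
    rw [hB]
    exact_mod_cast (Finset.card_le_univ _).trans_eq (Fintype.card_fin N)
  have hB0 : 0 ≤ B := Nat.cast_nonneg _
  have hdV : drift b k m (1 - ε)
      (fun q => Real.exp (τ * (∑ n, (q n : ℝ)) - τ * (N * H - 3 / 4 * E))) q
      ≤ V * (τ * (N - B - 15 / 16 * (N * ε))) := by
    refine (drift_exp_sum_le hlam hk hm hτ.le hτk1 _ q).trans ?_
    refine mul_le_mul_of_nonneg_left (mul_le_mul_of_nonneg_left ?_ hτ.le) hV0.le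
    -- The second-order losses of arrivals and of departures cost `N ε / 32` each, leaving `15/16`
    -- of the slack `N ε`.
    have h1 : (N : ℝ) * (1 - ε) * (τ * k) ≤ N * 1 * (ε / 32) := by
      gcongr
      linarith
    have h2 : B * τ ≤ N * (ε / 32) := mul_le_mul hBN hτ' hτ.le hN0.le
    linarith
  have hdV_le : drift b k m (1 - ε)
      (fun q => Real.exp (τ * (∑ n, (q n : ℝ)) - τ * (N * H - 3 / 4 * E))) q ≤ V * (τ * N) := by
    refine hdV.trans ?_
    refine mul_le_mul_of_nonneg_left (mul_le_mul_of_nonneg_left ?_ hτ.le) hV0.le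
    linarith
  have hdV_neg : y ≤ 7 / 8 * E → drift b k m (1 - ε)
      (fun q => Real.exp (τ * (∑ n, (q n : ℝ)) - τ * (N * H - 3 / 4 * E))) q
        ≤ -(τ * (N * ε) / 16) * V := by
    intro hyE
    have h1 : N - B ≤ 7 / 8 * (N * ε) := by
      have : H * (N - B) ≤ H * (7 / 8 * (N * ε)) := by
        refine (hidle.trans hyE).trans (le_of_eq ?_)
        rw [hE]
        ring
      exact le_of_mul_le_mul_left this hH0
    have h2 : V * (τ * (N - B - 15 / 16 * (N * ε))) ≤ V * (τ * (-(1 / 16) * (N * ε))) := by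
      refine mul_le_mul_of_nonneg_left (mul_le_mul_of_nonneg_left ?_ hτ.le) hV0.le
      linarith
    refine hdV.trans (h2.trans (le_of_eq ?_))
    ring
  have hdU_le : drift b k m (1 - ε) (fun q => Real.exp (τ * excess H q)) q ≤ U * (τ * (2 * N)) := by
    refine (drift_exp_excess_le (r := 1) H hlam hk hm hτ.le hτk1 q ?_).trans ?_
    · have h1 : (((Finset.univ : Finset (Fin N)).powersetCard m).filter
          fun A => ∑ n ∈ A, (H - q n) < k).card ≤ N.choose m := by
        refine (Finset.card_filter_le _ _).trans_eq ?_
        simp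
      rw [mul_one]
      exact_mod_cast h1
    · refine mul_le_mul_of_nonneg_left (mul_le_mul_of_nonneg_left ?_ hτ.le) hU0.le
      have h1 : (N : ℝ) * (1 - ε) * (1 + τ * k) ≤ N * 1 * (1 + 1) := by
        gcongr
        linarith
      have h2 : 0 ≤ ((Finset.univ.filter fun n => H < q n).card : ℝ) * (1 - τ) :=
        mul_nonneg (Nat.cast_nonneg _) (by linarith)
      linarith
  have hdU_neg : 5 / 8 * E ≤ y →
      drift b k m (1 - ε) (fun q => Real.exp (τ * excess H q)) q ≤ -(τ / 4) * U + τ := by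
    intro hyE
    refine (drift_exp_excess_le (r := 1 / (N : ℝ) ^ 2) H hlam hk hm hτ.le hτk1 q ?_).trans ?_
    · refine (card_sample_lt_le (by omega) H k m hH (fun n => H - q n)
        (fun n => Nat.sub_le _ _) ?_).trans (by gcongr)
      refine hmk.trans (mul_le_mul_of_nonneg_left ?_ (Nat.cast_nonneg m))
      rw [le_div_iff₀ hN0]
      have : (∑ n, ((H - q n : ℕ) : ℝ)) = y := by
        rw [hy]
        unfold deficit
        push_cast
        rfl
      rw [this]
      refine le_trans (le_of_eq ?_) hyE
      rw [hE]
      ring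
    · have h1 : (N : ℝ) * (1 - ε) * (1 + τ * k) * (1 / (N : ℝ) ^ 2) ≤ 1 / 4 := by
        calc _ ≤ (N : ℝ) * 1 * (1 + 1) * (1 / (N : ℝ) ^ 2) := by
              gcongr
              linarith
          _ = 2 / N := by field_simp; norm_num
          _ ≤ _ := by
              rw [div_le_iff₀ hN0]
              linarith
      -- With no queue above `H`, `U = 1` and the additive `τ` covers the drift. Otherwise at least
      -- one departure lowers the excess, at a net rate `1 - τ ≥ 1/2` against the arrival term
      -- `1/4`.
      rcases Nat.eq_zero_or_pos (Finset.univ.filter fun n => H < q n).card with h0 | h0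
      · have hz0 : z = 0 := by
          rw [hz]
          have : excess H q = 0 := Finset.sum_eq_zero fun n hn => by
            have h2 := Finset.card_eq_zero.1 h0
            have h3 : ¬ H < q n := fun h3 => by
              have : n ∈ Finset.univ.filter fun n => H < q n :=
                Finset.mem_filter.2 ⟨hn, h3⟩
              rw [h2] at this
              simp at this
            omega
          exact_mod_cast this
        have hU1 : U = 1 := by rw [hU, hz0, mul_zero, Real.exp_zero]
        rw [← hz, ← hU, h0, hU1]
        push_cast
        nlinarith
      · have h2 : (1 : ℝ) ≤ ((Finset.univ.filter fun n => H < q n).card : ℝ) := by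
          exact_mod_cast h0
        have h3 : 1 * (1 / 2) ≤ ((Finset.univ.filter fun n => H < q n).card : ℝ) * (1 - τ) :=
          mul_le_mul h2 (by linarith) (by norm_num) (by linarith)
        have h4 : U * (τ * (N * (1 - ε) * (1 + τ * k) * (1 / (N : ℝ) ^ 2)
            - ((Finset.univ.filter fun n => H < q n).card : ℝ) * (1 - τ)))
              ≤ U * (τ * (-(1 / 4))) := by
          refine mul_le_mul_of_nonneg_left (mul_le_mul_of_nonneg_left ?_ hτ.le) hU0.le
          linarith
        refine h4.trans ?_
        linarith
  have hsplit : drift b k m (1 - ε) (lyapunov τ ε H) q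
      = drift b k m (1 - ε) (fun q => Real.exp (τ * excess H q)) q + drift b k m (1 - ε)
        (fun q => Real.exp (τ * (∑ n, (q n : ℝ)) - τ * (N * H - 3 / 4 * E))) q :=
    drift_add b k m (1 - ε) _ _ q
  have hW : lyapunov τ ε H q = U + V := rfl
  rw [hsplit, hW]
  rcases lt_or_ge y (5 / 8 * E) with h1 | h1
  · have hUV : U ≤ ρ * V := by
      rw [hVU, hρ]
      calc U = U * (Real.exp (-(τ * E / 8)) * Real.exp (τ * E / 8)) := by
            rw [← Real.exp_add]
            simp
        _ ≤ U * (Real.exp (-(τ * E / 8)) * Real.exp (τ * (3 / 4 * E - y))) := by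
            gcongr
            nlinarith
        _ = _ := by ring
    have h2 := hdV_neg (by linarith)
    -- Crude growth of `U` uses up only half of the decrease of `V`; `N ε ≥ 8` makes the other half
    -- enough for `U + V`.
    have h3 : U * (τ * (2 * N)) ≤ τ * (N * ε) / 32 * V := by
      calc _ ≤ ρ * V * (τ * (2 * N)) := by gcongr
        _ = (64 * ρ) * (V * τ * N / 32) := by ring
        _ ≤ ε * (V * τ * N / 32) := by gcongr
        _ = _ := by ring
    have h4 : τ * 8 / 32 * V ≤ τ * (N * ε) / 32 * V := by gcongr
    have h5 : U ≤ V := by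
      refine hUV.trans (mul_le_of_le_one_left hV0.le ?_)
      linarith
    have h6 : τ * U ≤ τ * V := by gcongr
    have h7 : -(τ / 8) * (U + V) = -(τ * U) / 8 - τ * V / 8 := by ring
    have h8 := hdU_le
    linarith
  · rcases le_or_gt y (7 / 8 * E) with h2 | h2
    · have h3 := hdV_neg h2
      have h4 := hdU_neg h1
      have h5 : τ * 8 / 16 * V ≤ τ * (N * ε) / 16 * V := by gcongr
      have h6 : 0 ≤ τ * U := by positivity
      have h7 : 0 ≤ τ * V := by positivity
      have h8 : -(τ / 8) * (U + V) = -(τ * U) / 8 - τ * V / 8 := by ring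
      linarith
    · have hVρ : V ≤ ρ * U := by
        rw [hVU, hρ, mul_comm U]
        gcongr
        nlinarith
      have h4 := hdU_neg h1
      have h5 : V * (τ * N) ≤ τ * U / 16 := by
        calc _ ≤ ρ * U * (τ * N) := by gcongr
          _ = (16 * N * ρ) * (τ * U / 16) := by ring
          _ ≤ 1 * (τ * U / 16) := by gcongr
          _ = _ := one_mul _
      have h6 : τ * V ≤ τ * U / 2 := by
        calc τ * V ≤ τ * (ρ * U) := by gcongr
          _ ≤ τ * (1 / 2 * U) := by
            gcongr
            linarith
          _ = _ := by ring
      have h8 : -(τ / 8) * (U + V) = -(τ * U) / 8 - τ * V / 8 := by ring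
      have h9 := hdV_le
      linarith

/-! ### From the drift to the stationary mean -/

/-- A function whose drift is at most `-κ F + c` has stationary mean at most `c / κ`. -/
theorem IsStationary.sum_mul_le {N b k m : ℕ} {lam κ c : ℝ} {p : State N b → ℝ}
    (hp : IsStationary N b k m lam p) (F : (Fin N → ℕ) → ℝ)
    (hF : ∀ q : Fin N → ℕ, (∀ n, q n ≤ b) → F (toState b q).queues = F q)
    (hdrift : ∀ q, drift b k m lam F q ≤ -κ * F q + c) :
    κ * ∑ s, p s * F s.queues ≤ c := by
  have h0 := hp.sum_drift_eq_zero F hF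
  have h1 : ∑ s, p s * drift b k m lam F s.queues ≤ ∑ s, (c * p s - κ * (p s * F s.queues)) :=
    Finset.sum_le_sum fun s _ => by
      have := mul_le_mul_of_nonneg_left (hdrift s.queues) (hp.nonneg s)
      linarith
  rw [h0, Finset.sum_sub_distrib, ← Finset.mul_sum, ← Finset.mul_sum, hp.sum_eq_one] at h1
  linarith

/-- The non-asymptotic bound on the expected excess of the number of tasks per server. -/
theorem IsStationary.sum_max_total_le {N b k m H : ℕ} {ε τ h : ℝ} {p : State N b → ℝ}
    (hp : IsStationary N b k m (1 - ε) p) (hε0 : 0 < ε) (hε1 : ε ≤ 1) (hk : 0 < k)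
    (hH : 0 < H) (hHh : (H : ℝ) ≤ h) (hm : m ≤ N) (hτ : 0 < τ) (hN : 8 ≤ N) (hNε : 8 ≤ N * ε)
    (hτk : τ * k ≤ ε / 32) (hmk : (4 * k : ℝ) ≤ m * (5 / 8 * (ε * H)))
    (hkH : Real.exp (-(k / H : ℝ)) ≤ 1 / (N : ℝ) ^ 2)
    (hρε : 64 * Real.exp (-(τ * (ε * H * N) / 8)) ≤ ε)
    (hρN : 16 * N * Real.exp (-(τ * (ε * H * N) / 8)) ≤ 1) :
    ∑ s, p s * max (s.total - h * (1 - 1 / 2 * ε)) 0 ≤ 5 / (τ * N) := by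
  have hN0 : (0 : ℝ) < N := by
    have : (8 : ℝ) ≤ N := by exact_mod_cast hN
    linarith
  set ρ := Real.exp (-(τ * (ε * H * N) / 8)) with hρ
  have hρ0 : 0 < ρ := Real.exp_pos _
  have hmean : τ / 8 * ∑ s, p s * lyapunov τ ε H s.queues ≤ τ :=
    hp.sum_mul_le _ (fun q hq => lyapunov_toState τ ε H q hq)
      (drift_lyapunov_le hε0 hε1 hk hH hm hτ hN hNε hτk hmk hkH hρε hρN)
  have hmean8 : ∑ s, p s * lyapunov τ ε H s.queues ≤ 8 := by
    refine le_of_mul_le_mul_left ?_ (show 0 < τ / 8 by positivity)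
    linarith
  have hpt : ∀ s : State N b, max (s.total - h * (1 - 1 / 2 * ε)) 0
      ≤ ρ ^ 2 / (τ * N) * lyapunov τ ε H s.queues := by
    intro s
    have hly : 0 ≤ lyapunov τ ε H s.queues :=
      add_nonneg (Real.exp_pos _).le (Real.exp_pos _).le
    refine max_le ?_ (by positivity)
    have h1 : s.total - h * (1 - 1 / 2 * ε) ≤ s.total - H * (1 - 1 / 2 * ε) := by
      have : (H : ℝ) * (1 - 1 / 2 * ε) ≤ h * (1 - 1 / 2 * ε) := by
        gcongr
        linarith
      linarith
    set v : ℝ := s.total - H * (1 - 1 / 2 * ε) with hv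
    have h2 : τ * N * v ≤ Real.exp (τ * N * v) := by
      have := Real.add_one_le_exp (τ * N * v)
      linarith
    -- The threshold has `1/2 E` where `V` has `3/4 E`; the gap `E / 4` in the exponent gives `ρ ^
    -- 2`.
    have h3 : Real.exp (τ * N * v) = ρ ^ 2 * Real.exp (τ * (∑ n, (s.queues n : ℝ))
        - τ * (N * H - 3 / 4 * (ε * H * N))) := by
      rw [hρ, ← Real.exp_nat_mul, ← Real.exp_add, hv, s.total_eq]
      congr 1
      push_cast
      field_simp
      ring
    have h4 : Real.exp (τ * (∑ n, (s.queues n : ℝ)) - τ * (N * H - 3 / 4 * (ε * H * N)))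
        ≤ lyapunov τ ε H s.queues := le_add_of_nonneg_left (Real.exp_pos _).le
    have h5 : τ * N * v ≤ ρ ^ 2 * lyapunov τ ε H s.queues := by
      refine h2.trans (h3.le.trans ?_)
      gcongr
    refine h1.trans ?_
    rw [div_mul_eq_mul_div, le_div_iff₀ (by positivity)]
    linarith
  calc _ ≤ ∑ s, ρ ^ 2 / (τ * N) * (p s * lyapunov τ ε H s.queues) :=
        Finset.sum_le_sum fun s _ => by
          have := mul_le_mul_of_nonneg_left (hpt s) (hp.nonneg s)
          linarith
    _ = ρ ^ 2 / (τ * N) * ∑ s, p s * lyapunov τ ε H s.queues := by rw [Finset.mul_sum]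
    _ ≤ ρ ^ 2 / (τ * N) * 8 := by gcongr
    _ = (ρ ^ 2 * 8) / (τ * N) := by ring
    _ ≤ 5 / (τ * N) := by
        have : ρ ≤ 1 / 64 := by linarith
        gcongr
        nlinarith

end BatchFilling

/-! ### Choice of parameters and asymptotics -/

theorem theorem1 (α β : ℝ) (hα : 0 < α) (hα' : α < 1 / 2) (hβ : 0 < β) (hβ' : β ≤ 1)
    (k : ℕ → ℕ) (h d : ℕ → ℝ)
    (hk : (fun N : ℕ => (k N : ℝ)) =o[atTop]
      fun N : ℕ => (N : ℝ) ^ (1 / 2 - α) / Real.log N ^ 2)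
    (hk' : (fun N : ℕ => Real.log N) =O[atTop] fun N : ℕ => (k N : ℝ) / Real.log (k N))
    (hh : h =o[atTop] fun N : ℕ => Real.log (k N))
    (hh' : Tendsto h atTop atTop)
    (hd : ∀ᶠ N in atTop, 8 / ((1 - BatchFilling.load α β N) * h N) ≤ d N)
    (hdN : ∀ᶠ N in atTop, ⌊(k N : ℝ) * d N⌋₊ ≤ N) :
    ∀ᶠ N in atTop, ∀ p : BatchFilling.State N (BatchFilling.bufferSize α N (k N)) → ℝ,
      BatchFilling.IsStationary N (BatchFilling.bufferSize α N (k N)) (k N)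
        ⌊(k N : ℝ) * d N⌋₊ (BatchFilling.load α β N) p →
      ∑ s, p s * max (s.total - h N * (1 - 1 / 2 * β * (N : ℝ) ^ (-α))) 0
        ≤ 5 / (√(N : ℝ) * Real.log N) := by
  obtain ⟨C, hC0, hC⟩ := hk'.exists_pos
  have hlog : Tendsto (fun N : ℕ => Real.log N) atTop atTop :=
    Real.tendsto_log_atTop.comp tendsto_natCast_atTop_atTop
  have hpow : Tendsto (fun N : ℕ => (N : ℝ) ^ (1 - α)) atTop atTop :=
    (tendsto_rpow_atTop (by linarith)).comp tendsto_natCast_atTop_atTop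
  -- `β / 32` yields `τ k ≤ ε / 32`, and `1 / (2 C)` yields `2 h log N ≤ k`. With `h ≥ 10 + 16 / β`,
  -- rounding `h` down keeps `H ≥ 9/10 h` and `β H ≥ 16`.
  filter_upwards [hk.bound (show 0 < β / 32 by positivity), hC.bound,
    hh.bound (show 0 < 1 / (2 * C) by positivity), hh'.eventually_ge_atTop (10 + 16 / β),
    hd, hdN, hlog.eventually_ge_atTop 1, hpow.eventually_ge_atTop (8 / β),
    eventually_ge_atTop 16] with N hkN hkN' hhN hhN' hdN hmN hL hpN hN16 p hp
  have hN16' : (16 : ℝ) ≤ N := by exact_mod_cast hN16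
  have hN0 : (0 : ℝ) < N := by linarith
  have hs0 : 0 < √(N : ℝ) := Real.sqrt_pos.2 hN0
  have hss : √(N : ℝ) * √(N : ℝ) = N := Real.mul_self_sqrt hN0.le
  set L := Real.log N with hLdef
  have hL0 : 0 < L := by linarith
  set P : ℝ := (N : ℝ) ^ (-α) with hP
  have hP0 : 0 < P := Real.rpow_pos_of_pos hN0 _
  have hP1 : P ≤ 1 := Real.rpow_le_one_of_one_le_of_nonpos (by linarith) (by linarith)
  have hpow1 : (N : ℝ) ^ (1 - α) = N * P := by
    rw [sub_eq_add_neg, Real.rpow_add hN0, Real.rpow_one]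
  have hpow2 : (N : ℝ) ^ (1 / 2 - α) = √N * P := by
    rw [sub_eq_add_neg, Real.rpow_add hN0, ← Real.sqrt_eq_rpow]
  have hsP : 1 ≤ √(N : ℝ) * P := by
    rw [← hpow2]
    exact Real.one_le_rpow (by linarith) (by linarith)
  have hload : BatchFilling.load α β N = 1 - β * P := rfl
  rw [hload] at hp hdN
  rw [hpow1] at hpN
  rw [hpow2] at hkN
  set ε := β * P with hε
  have hε0 : 0 < ε := by positivity
  have hε1 : ε ≤ 1 := mul_le_one₀ hβ' hP0.le hP1
  have hh10 : 10 ≤ h N := by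
    have : 0 < 16 / β := by positivity
    linarith
  have hh0 : 0 < h N := by linarith
  rw [Real.norm_eq_abs, Real.norm_eq_abs, abs_of_pos hh0] at hhN
  -- `log k = 0` would force `h = 0`.
  have hlk : 0 < Real.log (k N) := by
    refine lt_of_le_of_ne (Real.log_natCast_nonneg _) fun h0 => ?_
    rw [← h0] at hhN
    simp at hhN
    linarith
  have hk0 : 0 < k N := by
    refine Nat.pos_of_ne_zero fun h0 => ?_
    rw [h0] at hlk
    simp at hlk
  have hk0' : (0 : ℝ) < k N := by exact_mod_cast hk0
  rw [abs_of_pos hlk] at hhN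
  rw [Real.norm_eq_abs, Real.norm_eq_abs, abs_of_pos hL0, abs_of_pos (by positivity)] at hkN'
  rw [Real.norm_eq_abs, Real.norm_eq_abs, abs_of_pos hk0', abs_of_pos (by positivity)] at hkN
  have hkh : 2 * L * h N ≤ k N := by
    calc 2 * L * h N ≤ 2 * (C * (k N / Real.log (k N))) * (1 / (2 * C) * Real.log (k N)) := by
          gcongr
      _ = k N := by field_simp
  set H := ⌊h N⌋₊ with hH
  have hHle : (H : ℝ) ≤ h N := Nat.floor_le hh0.le
  have hHge : h N - 1 ≤ H := (Nat.sub_one_lt_floor (h N)).le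
  have hH9 : 9 / 10 * h N ≤ H := by linarith
  have hH16 : 16 / β ≤ H := by linarith
  have hH0' : (0 : ℝ) < H := by linarith
  have hH0 : 0 < H := by exact_mod_cast hH0'
  have hkH : 2 * L * H ≤ k N := le_trans (by gcongr) hkh
  have hexpL : Real.exp (-(2 * L)) = 1 / (N : ℝ) ^ 2 := by
    rw [Real.exp_neg, two_mul, Real.exp_add, hLdef, Real.exp_log hN0]
    field_simp
  have hNε : 8 ≤ N * ε := by
    rw [div_le_iff₀ hβ] at hpN
    rw [hε]
    linarith
  have hτN : L / √(N : ℝ) * N = √(N : ℝ) * L := by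
    nth_rewrite 2 [← hss]
    field_simp
  have hρ : Real.exp (-(L / √(N : ℝ) * (ε * H * N) / 8)) ≤ 1 / (N : ℝ) ^ 2 := by
    rw [← hexpL]
    refine Real.exp_le_exp.2 (neg_le_neg ?_)
    have e1 : L / √(N : ℝ) * (ε * H * N) / 8 = (√(N : ℝ) * P) * (β * H) * L / 8 := by
      rw [show L / √(N : ℝ) * (ε * H * N) = L / √(N : ℝ) * N * (ε * H) by ring, hτN, hε]
      ring
    rw [e1]
    have h1 : 16 ≤ β * H := by
      rw [div_le_iff₀ hβ] at hH16
      linarith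
    -- Here `α < 1/2` enters, through `√N * N ^ (-α) ≥ 1`.
    have h2 : 1 * 16 ≤ (√(N : ℝ) * P) * (β * H) := mul_le_mul hsP h1 (by norm_num) (by linarith)
    have h3 : 1 * 16 * L ≤ (√(N : ℝ) * P) * (β * H) * L := by gcongr
    linarith
  have hmain := hp.sum_max_total_le (H := H) (τ := L / √(N : ℝ)) (h := h N) hε0 hε1 hk0 hH0 hHle
    hmN (by positivity) (by omega) hNε ?_ ?_ ?_ ?_ ?_
  · rw [hτN] at hmain
    convert hmain using 5
    rw [hε]
    ring
  · calc L / √(N : ℝ) * k N ≤ L / √(N : ℝ) * (β / 32 * (√(N : ℝ) * P / L ^ 2)) := by gcongr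
      _ = ε / 32 / L := by
          rw [hε]
          field_simp
      _ ≤ ε / 32 := div_le_self (by positivity) hL
  · have h1 : (k N : ℝ) * d N - 1 ≤ ⌊(k N : ℝ) * d N⌋₊ := (Nat.sub_one_lt_floor _).le
    have h2 : 8 / (ε * h N) ≤ d N := by
      have e : (1 - (1 - ε)) * h N = ε * h N := by ring
      rwa [e] at hdN
    have h3 : (k N : ℝ) * (8 / (ε * h N)) - 1 ≤ ⌊(k N : ℝ) * d N⌋₊ := by
      have : (k N : ℝ) * (8 / (ε * h N)) ≤ k N * d N := by gcongr
      linarith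
    have h4 : ((k N : ℝ) * (8 / (ε * h N)) - 1) * (5 / 8 * (ε * H))
        = 5 * k N * (H / h N) - 5 / 8 * (ε * H) := by
      field_simp
    have h5 : 9 / 10 ≤ H / h N := by
      rw [le_div_iff₀ hh0]
      exact hH9
    have h6 : 5 * (k N : ℝ) * (9 / 10) ≤ 5 * k N * (H / h N) := by gcongr
    have h7 : ε * H ≤ 1 * H := by gcongr
    have h8 : 2 * 1 * (H : ℝ) ≤ 2 * L * H := by gcongr
    have h9 := mul_le_mul_of_nonneg_right h3 (show 0 ≤ 5 / 8 * (ε * H) by positivity)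
    linarith
  · rw [← hexpL]
    refine Real.exp_le_exp.2 (neg_le_neg ?_)
    rwa [le_div_iff₀ hH0']
  · have h1 : 8 / N ≤ ε := by
      rw [div_le_iff₀ hN0]
      linarith
    have h2 : 64 * (1 / (N : ℝ) ^ 2) ≤ 8 / N := by
      rw [mul_one_div, div_le_div_iff₀ (by positivity) hN0]
      nlinarith
    linarith
  · calc _ ≤ 16 * N * (1 / (N : ℝ) ^ 2) := by gcongr
      _ = 16 / N := by field_simp
      _ ≤ 1 := by
          rw [div_le_one hN0]
          exact hN16'
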